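/- A word $w$ over a set $V$ is a finite sequence of elements of $V$; it is $k$-uniform if every element of $V$ occurs in it exactly $k$ times. Distinct $a,b\in V$ alternate in $w$ if the subword of $w$ consisting of all occurrences of $a$ and $b$ is of the form $abab\cdots$ or $baba\cdots$ (of even or odd length). A word over the vertex set of a simple graph $G$ represents $G$ if, for all distinct vertices $a,b$, the vertices $a$ and $b$ are adjacent if and only if they alternate in the word. The representation number $\mathcal R(G)$ is the smallest positive integer $k$ such that $G$ is represented by a $k$-uniform word. A melon graph is a simple graph $M=(E_1,\dots,E_m)$, $m\ge 1$, that is the union of paths $E_1,\dots,E_m$ (its constituent paths) with two common distinct endpoints $0$ and $0'$, which pairwise have no other vertex in common and at most one of which has length one. Let $\mathcal M_3$ be the family of melon graphs with exactly three constituent paths, each of length at least three. Let $\mathcal M_4$ be the family of melon graphs with exactly four constituent paths, one of which has length one (the edge $00'$) and the other three of which have length at least three. Theorem. Let $M$ be a melon graph. Then $\mathcal R(M)=3$ if and only if $M$ contains an induced subgraph from $\mathcal M_3\cup\mathcal M_4$. Otherwise $\mathcal R(M)\le 2$, and $M$ is represented by a $2$-uniform word. -/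

import Mathlib

namespace MelonWord

/-- Distinct letters `a` and `b` alternate in the word `w`: in the subword consisting of all
occurrences of `a` and `b`, no two consecutive letters are equal, i.e. this subword is of the form
`abab⋯` or `baba⋯`. -/
def Alternate {V : Type*} [DecidableEq V] (w : List V) (a b : V) : Prop :=
  (w.filter (fun x => x = a ∨ x = b)).IsChain (· ≠ ·)

/-- The word `w` over the vertex set of `G` represents `G`: two distinct vertices are adjacent
if and only if they alternate in `w`. -/
def Represents {V : Type*} [DecidableEq V] (w : List V) (G : SimpleGraph V) : Prop :=
  ∀ a b : V, a ≠ b → (G.Adj a b ↔ Alternate w a b)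

/-- Every letter of `V` appears exactly `k` times in the word `w`. -/
def IsUniform {V : Type*} [DecidableEq V] (k : ℕ) (w : List V) : Prop :=
  ∀ v : V, w.count v = k

/-- `G` is represented by a `k`-uniform word, where `k` is a positive integer. -/
def KWordRepresentable {V : Type*} [DecidableEq V] (k : ℕ) (G : SimpleGraph V) : Prop :=
  0 < k ∧ ∃ w : List V, IsUniform k w ∧ Represents w G

/-- The representation number: the smallest `k` such that `G` is represented by a `k`-uniform
word (and `⊤` if there is no such `k`). -/
noncomputable def representationNumber {V : Type*} [DecidableEq V] (G : SimpleGraph V) : ℕ∞ :=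
  sInf ((fun k : ℕ => (k : ℕ∞)) '' {k : ℕ | KWordRepresentable k G})

/-- `G` is the melon graph `(E 0, …, E (m - 1))` with endpoints `s` and `t`: the `E i` are `m ≥ 1`
paths from `s` to `t`, which pairwise share no vertex other than `s` and `t`, at most one of which
has length one, and which together have all the vertices and all the edges of `G`. -/
structure IsMelon {V : Type*} (G : SimpleGraph V) {s t : V} {m : ℕ}
    (E : Fin m → G.Walk s t) : Prop where
  pos : 0 < m
  endpoints_ne : s ≠ t
  isPath : ∀ i, (E i).IsPath
  disjoint : ∀ i j, i ≠ j → ∀ v, v ∈ (E i).support → v ∈ (E j).support → v = s ∨ v = t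
  length_one : ∀ i j, (E i).length = 1 → (E j).length = 1 → i = j
  vertices : ∀ v : V, ∃ i, v ∈ (E i).support
  edges : ∀ e ∈ G.edgeSet, ∃ i, e ∈ (E i).edges

/-- `G` is a melon graph. -/
def IsMelonGraph {V : Type*} (G : SimpleGraph V) : Prop :=
  ∃ (m : ℕ) (s t : V) (E : Fin m → G.Walk s t), IsMelon G E

/-- The family of melon graphs with three constituent paths, each of length at least three. -/
def InM3 {V : Type*} (G : SimpleGraph V) : Prop :=
  ∃ (s t : V) (E : Fin 3 → G.Walk s t), IsMelon G E ∧ ∀ i, 3 ≤ (E i).length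

/-- The family of melon graphs with four constituent paths, of which one is of length one and the
others are of length at least three. -/
def InM4 {V : Type*} (G : SimpleGraph V) : Prop :=
  ∃ (s t : V) (E : Fin 4 → G.Walk s t), IsMelon G E ∧
    ∃ i, (E i).length = 1 ∧ ∀ j, j ≠ i → 3 ≤ (E j).length

/-- `G` has an induced subgraph that belongs to one of the above two families. -/
def HasInducedM3OrM4 {V : Type*} (G : SimpleGraph V) : Prop :=
  ∃ S : Set V, InM3 (G.induce S) ∨ InM4 (G.induce S)

end MelonWord

/-! Call a constituent path long if its length is at least three. Everything depends on whether a
melon has three long paths.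

With three long paths no 2-uniform word exists. A 2-uniform word is a chord diagram in which
adjacency means crossing. The first vertices of the three paths give pairwise disjoint chords, all
crossing the chord of one endpoint, so the middle one separates the other two
(`IsChordModel.inside_trichotomy`). But each of the other two can be joined to the far endpoint by a
path that avoids the middle vertex and its neighbours, so both lie on the same side of the middle
chord (`IsMelon.inside_end_iff`). This applies to an induced subgraph because chord diagrams
restrict. Conversely, three long paths, together with the edge between the endpoints if there is
one, induce a member of one of the two families (`IsMelon.hasInducedM3OrM4`).

With at most two long paths, the short ones are placed in a word containing two factors made of both
endpoints, and each long path consumes one such factor (`RepresentsOn.add_ear_two`).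

Three copies of each letter always suffice: any two letters of a 3-uniform word can be joined by a
new path of length at least three (`RepresentsOn.ear_three`, `RepresentsOn.add_ear_three`). -/

namespace MelonWord

/-! ### Extending uniform words by new letters -/

section Words

variable {V : Type*} [DecidableEq V]

theorem alternate_comm {w : List V} {a b : V} : Alternate w a b ↔ Alternate w b a := by
  unfold Alternate
  simp only [or_comm]

theorem filter_pair_of_notMem_right {L : List V} {a b : V} (h : b ∉ L) :
    L.filter (fun x => x = a ∨ x = b) = List.replicate (L.count a) a := by
  rw [← List.filter_eq]
  refine List.filter_congr fun x hx => ?_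
  have : x ≠ b := fun e => h (e ▸ hx)
  simp [this]

theorem filter_pair_of_notMem_left {L : List V} {a b : V} (h : a ∉ L) :
    L.filter (fun x => x = a ∨ x = b) = List.replicate (L.count b) b := by
  simpa only [or_comm] using filter_pair_of_notMem_right (a := b) h

theorem not_alternate_of_gap {P M Q : List V} {u z : V} (h : z ∉ M) :
    ¬ Alternate (P ++ u :: (M ++ u :: Q)) u z := by
  intro hc
  unfold Alternate at hc
  simp only [List.filter_append, List.filter_cons, filter_pair_of_notMem_right h] at hc
  simp only [true_or, decide_true, if_true] at hc
  have h1 := (List.isChain_append.1 hc).2.1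
  cases hn : M.count u with
  | zero => simp [hn] at h1
  | succ n => simp [hn, List.replicate_succ] at h1

theorem alternate_filter_ne {w : List V} {u a b : V} (ha : a ≠ u) (hb : b ≠ u) :
    Alternate (w.filter (· ≠ u)) a b ↔ Alternate w a b := by
  unfold Alternate
  rw [List.filter_filter]
  have : ∀ x ∈ w, (decide (x = a ∨ x = b) && decide (x ≠ u)) = decide (x = a ∨ x = b) := by
    intro x _
    by_cases h : x = u
    · subst h; simp [Ne.symm ha, Ne.symm hb]
    · simp [h]
  rw [List.filter_congr this]

theorem filter_ne_of_notMem {w : List V} {u : V} (h : u ∉ w) : w.filter (· ≠ u) = w := by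
  rw [List.filter_eq_self]
  intro x hx
  simpa using fun e : x = u => h (e ▸ hx)

/-- The word `w` is over `S`, is `k`-uniform on `S`, and represents the subgraph of `G` induced
by `S`. -/
structure RepresentsOn (G : SimpleGraph V) (k : ℕ) (w : List V) (S : Set V) : Prop where
  count_eq : ∀ v ∈ S, w.count v = k
  notMem : ∀ v, v ∉ S → v ∉ w
  adj_iff : ∀ a ∈ S, ∀ b ∈ S, a ≠ b → (G.Adj a b ↔ Alternate w a b)

variable {G : SimpleGraph V} {S : Set V} {k : ℕ}

/-- Deleting `u` does not affect alternation among other letters, so only the pairs containing the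
new letter need checking. -/
theorem RepresentsOn.insert {w w' : List V} {u : V} (h : RepresentsOn G k w S)
    (hw : w'.filter (· ≠ u) = w) (hc : w'.count u = k)
    (hadj : ∀ z ∈ S, z ≠ u → (G.Adj u z ↔ Alternate w' u z)) :
    RepresentsOn G k w' (insert u S) where
  count_eq v hv := by
    by_cases e : v = u
    · rw [e, hc]
    · rw [← h.count_eq v (hv.resolve_left e), ← hw, List.count_filter (by simpa using e)]
  notMem v hv hm := by
    simp only [Set.mem_insert_iff, not_or] at hv
    refine h.notMem v hv.2 ?_
    rw [← hw, List.mem_filter]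
    exact ⟨hm, by simpa using hv.1⟩
  adj_iff a ha b hb hab := by
    by_cases ea : a = u
    · subst ea
      exact hadj b (hb.resolve_left (Ne.symm hab)) (Ne.symm hab)
    · by_cases eb : b = u
      · subst eb
        rw [G.adj_comm, alternate_comm]
        exact hadj a (ha.resolve_left ea) ea
      · rw [h.adj_iff a (ha.resolve_left ea) b (hb.resolve_left eb) hab, ← hw,
          alternate_filter_ne ea eb]

theorem RepresentsOn.kWordRepresentable {w : List V} (h : RepresentsOn G k w Set.univ)
    (hk : 0 < k) : KWordRepresentable k G :=
  ⟨hk, w, fun v => h.count_eq v trivial, fun a b => h.adj_iff a trivial b trivial⟩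

/-- In a `2`-uniform word, a new letter placed around a factor `L` alternates exactly with the
letters that occur once in `L`. -/
theorem RepresentsOn.window {A L B : List V} {u : V} (h : RepresentsOn G 2 (A ++ L ++ B) S)
    (hu : u ∉ S) (hadj : ∀ z ∈ S, G.Adj u z ↔ L.count z = 1) :
    RepresentsOn G 2 (A ++ u :: L ++ u :: B) (Insert.insert u S) := by
  have hm := h.notMem u hu
  simp only [List.mem_append, not_or] at hm
  obtain ⟨⟨hA, hL⟩, hB⟩ := hm
  refine h.insert ?_ ?_ ?_
  · simp [List.filter_append] at *
    rw [List.filter_eq_self.2, List.filter_eq_self.2, List.filter_eq_self.2]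
    all_goals
      intro x hx
      simp
      rintro rfl
      contradiction
  · simp [List.count_append, List.count_eq_zero_of_not_mem, hA, hL, hB]
  · intro z hz hzu
    rw [hadj z hz]
    have hc := h.count_eq z hz
    simp only [List.count_append] at hc
    unfold Alternate
    simp only [List.filter_append, List.filter_cons, filter_pair_of_notMem_left hA,
      filter_pair_of_notMem_left hL, filter_pair_of_notMem_left hB]
    simp only [true_or, decide_true, if_true]
    generalize A.count z = a at *
    generalize L.count z = l at *
    generalize B.count z = b at *
    have : (a = 0 ∧ l = 0 ∧ b = 2) ∨ (a = 0 ∧ l = 1 ∧ b = 1) ∨ (a = 0 ∧ l = 2 ∧ b = 0) ∨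
      (a = 1 ∧ l = 0 ∧ b = 1) ∨ (a = 1 ∧ l = 1 ∧ b = 0) ∨ (a = 2 ∧ l = 0 ∧ b = 0) := by omega
    rcases this with ⟨rfl, rfl, rfl⟩ | ⟨rfl, rfl, rfl⟩ | ⟨rfl, rfl, rfl⟩ | ⟨rfl, rfl, rfl⟩ |
      ⟨rfl, rfl, rfl⟩ | ⟨rfl, rfl, rfl⟩ <;> simp [List.replicate_succ, hzu, Ne.symm hzu]

theorem exists_split_three {w : List V} {x : V} (h : w.count x = 3) :
    ∃ P A B C, w = P ++ x :: (A ++ x :: (B ++ x :: C)) ∧ x ∉ P ∧ x ∉ A ∧ x ∉ B ∧ x ∉ C := by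
  have h1 : w.filter (· = x) = [x, x, x] := by rw [List.filter_eq, h]; rfl
  obtain ⟨P, w1, rfl, hP, -, h1⟩ := List.filter_eq_cons_iff.1 h1
  obtain ⟨A, w2, rfl, hA, -, h1⟩ := List.filter_eq_cons_iff.1 h1
  obtain ⟨B, C, rfl, hB, -, h1⟩ := List.filter_eq_cons_iff.1 h1
  rw [List.filter_eq_nil_iff] at h1
  refine ⟨P, A, B, C, rfl, ?_, ?_, ?_, ?_⟩
  · exact fun h => hP _ h (by simp)
  · exact fun h => hA _ h (by simp)
  · exact fun h => hB _ h (by simp)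
  · exact fun h => h1 _ h (by simp)

theorem RepresentsOn.leaf_three {w : List V} {x u : V} (h : RepresentsOn G 3 w S)
    (hx : x ∈ S) (hu : u ∉ S) (hadj : ∀ z ∈ S, G.Adj u z ↔ z = x) :
    ∃ w', RepresentsOn G 3 w' (Insert.insert u S) := by
  obtain ⟨P, A, B, C, rfl, hP, hA, hB, hC⟩ := exists_split_three (h.count_eq x hx)
  have hm := h.notMem u hu
  simp only [List.mem_append, List.mem_cons, not_or] at hm
  obtain ⟨uP, ux, uA, -, uB, -, uC⟩ := hm
  -- Restricted to `u` and `x` the new word is `uxuxux`, while the factor `uxu` prevents `u` from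
  -- alternating with any other letter.
  refine ⟨P ++ u :: x :: u :: (A ++ x :: (u :: B ++ x :: C)), h.insert ?_ ?_ ?_⟩
  · have := Ne.symm ux
    simp only [List.filter_append, List.filter_cons, filter_ne_of_notMem, uP, uA, uB, uC,
      not_false_eq_true]
    simp [this]
  · simp [List.count_append, List.count_eq_zero_of_not_mem, uP, uA, uB, uC,
      Ne.symm ux]
  · intro z hz hzu
    rw [hadj z hz]
    constructor
    · rintro rfl
      unfold Alternate
      simp only [List.filter_append, List.filter_cons, filter_pair_of_notMem_left uP,
        filter_pair_of_notMem_left uA, filter_pair_of_notMem_left uB,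
        filter_pair_of_notMem_left uC, List.count_eq_zero_of_not_mem, hP, hA, hB, hC,
        not_false_eq_true]
      simp [hzu, Ne.symm hzu]
    · intro ha
      by_contra hzx
      exact not_alternate_of_gap (P := P) (M := [x]) (z := z) (by simpa using hzx) ha

theorem count_and_getLast_of_isChain_pair {a b : V} (hab : a ≠ b) :
    ∀ (l : List V) (c d : V), (c = a ∧ d = b ∨ c = b ∧ d = a) → (∀ x ∈ l, x = a ∨ x = b) →
      (c :: l).IsChain (· ≠ ·) →
      (l.count c = l.count d ∧ (c :: l).getLast? = some c) ∨
      (l.count d = l.count c + 1 ∧ (c :: l).getLast? = some d)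
  | [], c, d, _, _, _ => by simp
  | e :: l, c, d, hcd, hl, hc => by
    have hcd' : c ≠ d := by rcases hcd with ⟨rfl, rfl⟩ | ⟨rfl, rfl⟩ <;> [exact hab; exact hab.symm]
    have hce : c ≠ e := (List.isChain_cons_cons.1 hc).1
    have hed : e = d := by
      have := hl e (by simp)
      rcases hcd with ⟨rfl, rfl⟩ | ⟨rfl, rfl⟩
      · exact this.resolve_left (Ne.symm hce)
      · exact this.resolve_right (Ne.symm hce)
    subst hed
    have ih := count_and_getLast_of_isChain_pair hab l e c (by tauto)
      (fun x hx => hl x (by simp [hx])) (List.isChain_cons_cons.1 hc).2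
    rw [List.getLast?_cons_cons]
    simp only [List.count_cons, beq_iff_eq, hce.symm, if_true, if_false]
    rcases ih with ⟨h1, h2⟩ | ⟨h1, h2⟩
    · exact Or.inr ⟨by omega, h2⟩
    · exact Or.inl ⟨by omega, h2⟩

/-- Equal counts force an alternating word to end in the letter it does not start with, so its first
letter can be moved to the end. Hence alternation in uniform words is a cyclic property. -/
theorem isChain_ne_rotate_one {a b c : V} (hab : a ≠ b) {l : List V}
    (hl : ∀ x ∈ c :: l, x = a ∨ x = b) (hcount : (c :: l).count a = (c :: l).count b)
    (hc : (c :: l).IsChain (· ≠ ·)) : (l ++ [c]).IsChain (· ≠ ·) := by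
  have key : ∀ d, (c = a ∧ d = b ∨ c = b ∧ d = a) → c ≠ d →
      (c :: l).count c = (c :: l).count d → (l ++ [c]).IsChain (· ≠ ·) := by
    intro d hd hcd hcount
    have h1 := count_and_getLast_of_isChain_pair hab l c d hd (fun x hx => hl x (by simp [hx])) hc
    simp only [List.count_cons, beq_iff_eq, hcd, if_true, if_false] at hcount
    have h2 : (c :: l).getLast? = some d := by
      rcases h1 with h1 | h1
      · omega
      · exact h1.2
    rw [List.isChain_append]
    refine ⟨hc.tail, by simp, ?_⟩
    intro x hx y hy
    simp only [List.head?_cons, Option.mem_def, Option.some.injEq] at hy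
    subst hy
    cases l with
    | nil => simp at hx
    | cons e l =>
      rw [List.getLast?_cons_cons] at h2
      rw [Option.mem_def, h2] at hx
      simp only [Option.some.injEq] at hx
      exact hx ▸ hcd.symm
  rcases hl c (by simp) with rfl | rfl
  · exact key b (Or.inl ⟨rfl, rfl⟩) hab hcount
  · exact key a (Or.inr ⟨rfl, rfl⟩) hab.symm hcount.symm

theorem Alternate.rotate_one {a b c : V} (hab : a ≠ b) {l : List V}
    (hcount : (c :: l).count a = (c :: l).count b) (h : Alternate (c :: l) a b) :
    Alternate (l ++ [c]) a b := by
  unfold Alternate at *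
  by_cases hc : c = a ∨ c = b
  · rw [List.filter_append, List.filter_cons_of_pos (by simpa using hc), List.filter_nil]
    rw [List.filter_cons_of_pos (by simpa using hc)] at h
    refine isChain_ne_rotate_one hab ?_ ?_ h
    · intro x hx
      rcases List.mem_cons.1 hx with rfl | hx
      · exact hc
      · simpa using (List.mem_filter.1 hx).2
    · rw [← List.filter_cons_of_pos (p := fun x => decide (x = a ∨ x = b)) (by simpa using hc),
        List.count_filter (by simp), List.count_filter (by simp), hcount]
  · rw [List.filter_append, List.filter_cons_of_neg (by simpa using hc)]
    rwa [List.filter_cons_of_neg (by simpa using hc), List.filter_nil, List.append_nil] at *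

theorem Alternate.rotate {a b : V} (hab : a ≠ b) :
    ∀ (l₁ l₂ : List V), (l₁ ++ l₂).count a = (l₁ ++ l₂).count b → Alternate (l₁ ++ l₂) a b →
      Alternate (l₂ ++ l₁) a b
  | [], l₂, _, h => by simpa using h
  | c :: l₁, l₂, hc, h => by
    have h1 := Alternate.rotate_one hab (l := l₁ ++ l₂) hc h
    have h2 := Alternate.rotate hab l₁ (l₂ ++ [c])
      (by simp only [List.count_append, List.count_cons, List.count_nil, List.cons_append] at hc ⊢
          omega) (by simpa using h1)
    simpa using h2

theorem RepresentsOn.rotate {l₁ l₂ : List V} (h : RepresentsOn G k (l₁ ++ l₂) S) :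
    RepresentsOn G k (l₂ ++ l₁) S where
  count_eq v hv := by
    rw [← h.count_eq v hv, List.count_append, List.count_append, add_comm]
  notMem v hv := by
    have := h.notMem v hv
    simp only [List.mem_append] at *
    tauto
  adj_iff a ha b hb hab := by
    rw [h.adj_iff a ha b hb hab]
    have e : (l₁ ++ l₂).count a = (l₁ ++ l₂).count b := by
      rw [h.count_eq a ha, h.count_eq b hb]
    refine ⟨Alternate.rotate hab _ _ e, Alternate.rotate hab _ _ ?_⟩
    simp only [List.count_append] at *
    omega

theorem length_eq_count_add_count {x y : V} (hxy : x ≠ y) {l : List V}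
    (hl : ∀ z ∈ l, z = x ∨ z = y) : l.length = l.count x + l.count y := by
  rw [List.length_eq_countP_add_countP (· = x), List.count, List.count]
  congr 1
  refine List.countP_congr fun z hz => ?_
  rcases hl z hz with rfl | rfl <;> simp [hxy, hxy.symm]

/-- Every circular arrangement of three letters `x` and three letters `y` has an `x` opposite to a
`y` with one `x` and one `y` on each side. -/
theorem exists_rotation_antipodal {x y : V} (hxy : x ≠ y) {l : List V}
    (hl : ∀ z ∈ l, z = x ∨ z = y) (hx : l.count x = 3) (hy : l.count y = 3) :
    ∃ l₁ l₂ A B, l = l₁ ++ l₂ ∧ l₂ ++ l₁ = x :: (A ++ y :: B) ∧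
      A.count x = 1 ∧ A.count y = 1 ∧ B.count x = 1 ∧ B.count y = 1 := by
  have hlen : l.length = 6 := by
    rw [length_eq_count_add_count hxy hl, hx, hy]
  match l, hlen with
  | [a, b, c, d, e, f], _ =>
    have ha := hl a (by simp)
    have hb := hl b (by simp)
    have hc := hl c (by simp)
    have hd := hl d (by simp)
    have he := hl e (by simp)
    have hf := hl f (by simp)
    -- One disjunct for each starting position on the circle. One or all three of the opposite pairs
    -- are mixed, since `x` occurs an odd number of times; checking all cases finds a suitable pair.
    have key : (a = x ∧ d = y ∧ b ≠ c ∧ e ≠ f) ∨ (b = x ∧ e = y ∧ c ≠ d ∧ f ≠ a) ∨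
        (c = x ∧ f = y ∧ d ≠ e ∧ a ≠ b) ∨ (d = x ∧ a = y ∧ e ≠ f ∧ b ≠ c) ∨
        (e = x ∧ b = y ∧ f ≠ a ∧ c ≠ d) ∨ (f = x ∧ c = y ∧ a ≠ b ∧ d ≠ e) := by
      rcases ha with ha | ha <;> rcases hb with hb | hb <;> rcases hc with hc | hc <;>
        rcases hd with hd | hd <;> rcases he with he | he <;> rcases hf with hf | hf <;>
        simp [ha, hb, hc, hd, he, hf, hxy, hxy.symm] at hx hy ⊢
    have pair : ∀ p q : V, (p = x ∨ p = y) → (q = x ∨ q = y) → p ≠ q →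
        [p, q].count x = 1 ∧ [p, q].count y = 1 := by
      rintro p q (rfl | rfl) (rfl | rfl) h <;> simp_all [List.count_cons]
    rcases key with ⟨rfl, rfl, h1, h2⟩ | ⟨rfl, rfl, h1, h2⟩ | ⟨rfl, rfl, h1, h2⟩ |
      ⟨rfl, rfl, h1, h2⟩ | ⟨rfl, rfl, h1, h2⟩ | ⟨rfl, rfl, h1, h2⟩
    · exact ⟨[], [a, b, c, d, e, f], [b, c], [e, f], rfl, rfl, (pair _ _ hb hc h1).1,
        (pair _ _ hb hc h1).2, pair _ _ he hf h2⟩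
    · exact ⟨[a], [b, c, d, e, f], [c, d], [f, a], rfl, rfl, (pair _ _ hc hd h1).1,
        (pair _ _ hc hd h1).2, pair _ _ hf ha h2⟩
    · exact ⟨[a, b], [c, d, e, f], [d, e], [a, b], rfl, rfl, (pair _ _ hd he h1).1,
        (pair _ _ hd he h1).2, pair _ _ ha hb h2⟩
    · exact ⟨[a, b, c], [d, e, f], [e, f], [b, c], rfl, rfl, (pair _ _ he hf h1).1,
        (pair _ _ he hf h1).2, pair _ _ hb hc h2⟩
    · exact ⟨[a, b, c, d], [e, f], [f, a], [c, d], rfl, rfl, (pair _ _ hf ha h1).1,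
        (pair _ _ hf ha h1).2, pair _ _ hc hd h2⟩
    · exact ⟨[a, b, c, d, e], [f], [a, b], [d, e], rfl, rfl, (pair _ _ ha hb h1).1,
        (pair _ _ ha hb h1).2, pair _ _ hd he h2⟩

theorem RepresentsOn.exists_antipodal {w : List V} {x y : V} (h : RepresentsOn G 3 w S)
    (hxy : x ≠ y) (hx : x ∈ S) (hy : y ∈ S) :
    ∃ A B, RepresentsOn G 3 (x :: (A ++ y :: B)) S ∧
      A.count x = 1 ∧ A.count y = 1 ∧ B.count x = 1 ∧ B.count y = 1 := by
  obtain ⟨l₁, l₂, A', B', e, e', c⟩ := exists_rotation_antipodal hxy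
    (l := w.filter (fun z => z = x ∨ z = y)) (fun z hz => by simpa using (List.mem_filter.1 hz).2)
    (by rw [List.count_filter (by simp), h.count_eq x hx])
    (by rw [List.count_filter (by simp), h.count_eq y hy])
  obtain ⟨w₁, w₂, rfl, rfl, rfl⟩ := List.filter_eq_append_iff.1 e
  rw [← List.filter_append] at e'
  obtain ⟨P, w', ew, hP, -, e'⟩ := List.filter_eq_cons_iff.1 e'
  obtain ⟨A, w'', rfl, rfl, e''⟩ := List.filter_eq_append_iff.1 e'
  obtain ⟨Q, B, rfl, hQ, -, rfl⟩ := List.filter_eq_cons_iff.1 e''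
  have hr := h.rotate
  rw [ew] at hr
  replace hr := hr.rotate
  -- `P` and `Q` contain neither `x` nor `y`, so absorbing them leaves the four counts unchanged.
  refine ⟨A ++ Q, B ++ P, by simpa using hr, ?_⟩
  have hPx : x ∉ P := fun hh => hP _ hh (by simp)
  have hPy : y ∉ P := fun hh => hP _ hh (by simp)
  have hQx : x ∉ Q := fun hh => hQ _ hh (by simp)
  have hQy : y ∉ Q := fun hh => hQ _ hh (by simp)
  simpa [List.count_append, List.count_eq_zero_of_not_mem, hPx, hPy, hQx, hQy,
    List.count_filter] using c

/-- A path of length three between two vertices can be added to a `3`-uniform word. -/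
theorem RepresentsOn.ear_three {w : List V} {x y u v : V} (h : RepresentsOn G 3 w S)
    (hxy : x ≠ y) (hx : x ∈ S) (hy : y ∈ S) (hu : u ∉ S) (hv : v ∉ S) (huv : G.Adj u v)
    (hadju : ∀ z ∈ S, G.Adj u z ↔ z = x) (hadjv : ∀ z ∈ S, G.Adj v z ↔ z = y) :
    ∃ w', RepresentsOn G 3 w' (Insert.insert v (Insert.insert u S)) := by
  obtain ⟨A, B, h, hAx, hAy, hBx, hBy⟩ := h.exists_antipodal hxy hx hy
  have hmu := h.notMem u hu
  have hmv := h.notMem v hv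
  simp only [List.mem_append, List.mem_cons, not_or] at hmu hmv
  obtain ⟨ux, uA, uy, uB⟩ := hmu
  obtain ⟨vx, vA, vy, vB⟩ := hmv
  have huv' := huv.ne
  -- Since `A` and `B` contain one `x` each, the restriction to `u` and `x` is `uxuxux`.
  have h1 : RepresentsOn G 3 ([] ++ u :: ([x] ++ u :: (A ++ u :: y :: B)))
      (Insert.insert u S) := by
    refine h.insert ?_ ?_ ?_
    · simp only [List.filter_append, List.filter_cons, filter_ne_of_notMem, uA, uB,
        not_false_eq_true]
      simp [Ne.symm ux, Ne.symm uy]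
    · simp [List.count_append, List.count_eq_zero_of_not_mem, uA, uB, Ne.symm ux, Ne.symm uy]
    · intro z hz hzu
      rw [hadju z hz]
      constructor
      · rintro rfl
        unfold Alternate
        simp only [List.filter_append, List.filter_cons, filter_pair_of_notMem_left uA,
          filter_pair_of_notMem_left uB, hAx, hBx]
        simp [hzu, Ne.symm hzu, Ne.symm uy, Ne.symm hxy]
      · intro ha
        by_contra hzx
        exact not_alternate_of_gap (z := z) (by simpa using hzx) ha
  -- The restrictions are `uvuvuv` and `vyvyvy`; the factor `vuyv` excludes all other letters as
  -- neighbours of `v`.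
  refine ⟨(u :: x :: v :: u :: A) ++ v :: ([u, y] ++ v :: B), h1.insert ?_ ?_ ?_⟩
  · simp only [List.filter_append, List.filter_cons, filter_ne_of_notMem, vA, vB,
      not_false_eq_true]
    simp [Ne.symm vx, Ne.symm vy, huv']
  · simp [List.count_append, List.count_eq_zero_of_not_mem, vA, vB, Ne.symm vx, Ne.symm vy, huv']
  · intro z hz hzv
    by_cases hzu : z = u
    · subst hzu
      simp only [huv.symm, true_iff]
      unfold Alternate
      simp only [List.filter_append, List.filter_cons, filter_pair_of_notMem_left vA,
        filter_pair_of_notMem_left vB, List.count_eq_zero_of_not_mem, uA, uB, not_false_eq_true]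
      simp [Ne.symm vx, Ne.symm ux, Ne.symm vy, Ne.symm uy, hzv, Ne.symm hzv]
    · rw [hadjv z (hz.resolve_left hzu)]
      constructor
      · rintro rfl
        unfold Alternate
        simp only [List.filter_append, List.filter_cons, filter_pair_of_notMem_left vA,
          filter_pair_of_notMem_left vB, hAy, hBy]
        simp [hzv, Ne.symm hzv, huv', Ne.symm hzu, Ne.symm vx, hxy]
      · intro ha
        by_contra hzy
        exact not_alternate_of_gap (z := z) (by simp [hzu, hzy]) ha

end Words

/-! ### Attaching a path to a represented set -/

section Ears

variable {V : Type*}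

/-- `p 0, …, p n` is a path between two vertices of `S` whose interior vertices lie outside `S`
and have degree two in `G`. -/
structure IsEar (G : SimpleGraph V) (S : Set V) (p : ℕ → V) (n : ℕ) : Prop where
  inj : ∀ i ≤ n, ∀ j ≤ n, p i = p j → i = j
  start_mem : p 0 ∈ S
  end_mem : p n ∈ S
  notMem : ∀ j, 1 ≤ j → j < n → p j ∉ S
  adj_iff : ∀ j, 1 ≤ j → j < n → ∀ z, G.Adj (p j) z ↔ z = p (j - 1) ∨ z = p (j + 1)

/-- The set `S` together with the first `k` vertices after `p 0`. -/
def addVerts (S : Set V) (p : ℕ → V) (k : ℕ) : Set V :=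
  S ∪ {v | ∃ j, 1 ≤ j ∧ j ≤ k ∧ p j = v}

theorem addVerts_zero (S : Set V) (p : ℕ → V) : addVerts S p 0 = S := by
  ext v
  simp only [addVerts, Set.mem_union, Set.mem_ofPred_eq, or_iff_left_iff_imp]
  rintro ⟨j, h1, h2, -⟩
  omega

theorem addVerts_succ (S : Set V) (p : ℕ → V) (k : ℕ) :
    addVerts S p (k + 1) = insert (p (k + 1)) (addVerts S p k) := by
  ext v
  simp only [addVerts, Set.mem_union, Set.mem_ofPred_eq, Set.mem_insert_iff]
  constructor
  · rintro (h | ⟨j, h1, h2, rfl⟩)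
    · exact Or.inr (Or.inl h)
    · rcases Nat.lt_or_ge k j with h | h
      · obtain rfl : j = k + 1 := by omega
        exact Or.inl rfl
      · exact Or.inr (Or.inr ⟨j, h1, h, rfl⟩)
  · rintro (rfl | h | ⟨j, h1, h2, rfl⟩)
    · exact Or.inr ⟨k + 1, by omega, le_rfl, rfl⟩
    · exact Or.inl h
    · exact Or.inr ⟨j, h1, by omega, rfl⟩

variable {G : SimpleGraph V} {S : Set V} {p : ℕ → V} {n k : ℕ}

theorem IsEar.reverse (h : IsEar G S p n) : IsEar G S (fun j => p (n - j)) n where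
  inj i hi j hj e := by
    have := h.inj _ (Nat.sub_le n i) _ (Nat.sub_le n j) e
    omega
  start_mem := by simpa using h.end_mem
  end_mem := by simpa using h.start_mem
  notMem j h1 h2 := h.notMem _ (by omega) (by omega)
  adj_iff j h1 h2 z := by
    rw [h.adj_iff _ (by omega) (by omega), or_comm, show n - (j - 1) = n - j + 1 by omega,
      show n - (j + 1) = n - j - 1 by omega]

theorem addVerts_reverse (S : Set V) (p : ℕ → V) (n : ℕ) :
    addVerts S (fun j => p (n - j)) (n - 1) = addVerts S p (n - 1) := by
  ext v
  simp only [addVerts, Set.mem_union, Set.mem_ofPred_eq]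
  refine or_congr Iff.rfl ⟨?_, ?_⟩
  · rintro ⟨j, h1, h2, rfl⟩
    exact ⟨n - j, by omega, by omega, rfl⟩
  · rintro ⟨j, h1, h2, rfl⟩
    exact ⟨n - j, by omega, by omega, by congr 1; omega⟩

theorem IsEar.mem_addVerts (h : IsEar G S p n) (hk : k < n) : p k ∈ addVerts S p k := by
  rcases Nat.eq_zero_or_pos k with rfl | hk
  · exact Or.inl h.start_mem
  · exact Or.inr ⟨k, hk, le_rfl, rfl⟩

theorem IsEar.notMem_addVerts (h : IsEar G S p n) {j : ℕ} (hj : k < j) (hn : j < n) :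
    p j ∉ addVerts S p k := by
  rintro (hh | ⟨i, h1, h2, e⟩)
  · exact h.notMem j (by omega) hn hh
  · have := h.inj i (by omega) j (by omega) e
    omega

theorem IsEar.adj_addVerts_iff (h : IsEar G S p n) (hk : k + 2 < n) {z : V}
    (hz : z ∈ addVerts S p k) : G.Adj (p (k + 1)) z ↔ z = p k := by
  rw [h.adj_iff _ (by omega) (by omega), Nat.add_sub_cancel, or_iff_left]
  rintro rfl
  exact h.notMem_addVerts (by omega) (by omega) hz

theorem IsEar.adj_last_iff (h : IsEar G S p n) {j k : ℕ} (hj : k + 1 < j) (hn : j + 1 = n)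
    {z : V} (hz : z ∈ addVerts S p k) : G.Adj (p j) z ↔ z = p n := by
  rw [h.adj_iff _ (by omega) (by omega), hn, or_iff_right]
  rintro rfl
  exact h.notMem_addVerts (j := j - 1) (by omega) (by omega) hz

variable [DecidableEq V]

/-- All interior vertices but the last two are attached one by one as leaves; the remaining path of
length three is closed by `RepresentsOn.ear_three`. -/
theorem RepresentsOn.add_ear_three {w : List V} (h : RepresentsOn G 3 w S) (hp : IsEar G S p n)
    (hn : 3 ≤ n) : ∃ w', RepresentsOn G 3 w' (addVerts S p (n - 1)) := by
  have key : ∀ k, k + 3 ≤ n → ∃ w', RepresentsOn G 3 w' (addVerts S p k) := by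
    intro k
    induction k with
    | zero => exact fun _ => ⟨w, by rwa [addVerts_zero]⟩
    | succ k ih =>
      intro hk
      obtain ⟨w', h'⟩ := ih (by omega)
      rw [addVerts_succ]
      exact h'.leaf_three (hp.mem_addVerts (by omega))
        (hp.notMem_addVerts (by omega) (by omega))
        (fun z hz => hp.adj_addVerts_iff (by omega) hz)
  obtain ⟨k, rfl⟩ : ∃ k, n = k + 3 := ⟨n - 3, by omega⟩
  obtain ⟨w', h'⟩ := key k le_rfl
  rw [show k + 3 - 1 = k + 1 + 1 by omega, addVerts_succ, addVerts_succ]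
  refine h'.ear_three (x := p k) (y := p (k + 3)) ?_ (hp.mem_addVerts (by omega))
    (Or.inl hp.end_mem)
    (hp.notMem_addVerts (by omega) (by omega)) (hp.notMem_addVerts (by omega) (by omega)) ?_
    (fun z hz => hp.adj_addVerts_iff (by omega) hz) (fun z hz => hp.adj_last_iff (by omega) rfl hz)
  · intro e
    have := hp.inj _ (by omega) _ (by omega) e
    omega
  · rw [hp.adj_iff _ (by omega) (by omega)]
    exact Or.inr rfl

/-- The factor `p k, p n` travels along the path: wrapping `p (k + 1)` around `p k` alone makes it a
leaf at `p k` and leaves `p (k + 1)` next to `p n`. The last interior vertex is wrapped around both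
letters. `A` and `B` stay intact, so other factors remain available. -/
theorem RepresentsOn.add_ear_two {A B : List V} (h : RepresentsOn G 2 (A ++ [p 0, p n] ++ B) S)
    (hp : IsEar G S p n) (hn : 2 ≤ n) :
    ∃ L, RepresentsOn G 2 (A ++ L ++ B) (addVerts S p (n - 1)) := by
  have key : ∀ k, k + 2 ≤ n → ∃ L, RepresentsOn G 2 (A ++ L ++ [p k, p n] ++ B)
      (addVerts S p k) := by
    intro k
    induction k with
    | zero => exact fun _ => ⟨[], by simpa [addVerts_zero] using h⟩
    | succ k ih =>
      intro hk
      obtain ⟨L, h'⟩ := ih (by omega)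
      rw [addVerts_succ]
      have := RepresentsOn.window (A := A ++ L) (L := [p k]) (B := p n :: B) (by simpa using h')
        (hp.notMem_addVerts (k := k) (j := k + 1) (by omega) (by omega))
        (fun z hz => by
          rw [hp.adj_addVerts_iff (by omega) hz, List.count_singleton]
          by_cases e : z = p k
          · simp [e]
          · simp [e, Ne.symm e])
      exact ⟨L ++ [p (k + 1), p k], by simpa using this⟩
  obtain ⟨k, rfl⟩ : ∃ k, n = k + 2 := ⟨n - 2, by omega⟩
  obtain ⟨L, h'⟩ := key k le_rfl
  rw [show k + 2 - 1 = k + 1 by omega, addVerts_succ]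
  have hne : p k ≠ p (k + 2) := fun e => by
    have := hp.inj _ (by omega) _ (by omega) e
    omega
  have := h'.window (hp.notMem_addVerts (k := k) (j := k + 1) (by omega) (by omega))
    (fun z hz => by
      rw [hp.adj_iff _ (by omega) (by omega), Nat.add_sub_cancel]
      by_cases e : z = p k
      · subst e; simp [hne.symm]
      · by_cases e' : z = p (k + 2)
        · subst e'; simp [hne]
        · simp [e, e', Ne.symm e, Ne.symm e'])
  exact ⟨L ++ p (k + 1) :: [p k, p (k + 2)] ++ [p (k + 1)], by simpa using this⟩

end Ears

/-! ### Adjacency and vertex sets in a melon graph -/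

section Melon

variable {V : Type*} {G : SimpleGraph V} {s t : V} {m : ℕ} {E : Fin m → G.Walk s t}

theorem IsMelon.getVert_inj (h : IsMelon G E) (i : Fin m) {j k : ℕ} (hj : j ≤ (E i).length)
    (hk : k ≤ (E i).length) (e : (E i).getVert j = (E i).getVert k) : j = k :=
  (h.isPath i).getVert_injOn hj hk e

theorem IsMelon.getVert_ne_start (h : IsMelon G E) (i : Fin m) {j : ℕ} (hj : 1 ≤ j)
    (hl : j ≤ (E i).length) : (E i).getVert j ≠ s := by
  rw [Ne, (h.isPath i).getVert_eq_start_iff hl]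
  omega

theorem IsMelon.getVert_ne_end (h : IsMelon G E) (i : Fin m) {j : ℕ}
    (hl : j < (E i).length) : (E i).getVert j ≠ t := by
  rw [Ne, (h.isPath i).getVert_eq_end_iff hl.le]
  omega

theorem IsMelon.eq_of_mem_support (h : IsMelon G E) {i k : Fin m} {j : ℕ} (hj : 1 ≤ j)
    (hl : j < (E i).length) (hk : (E i).getVert j ∈ (E k).support) : i = k := by
  by_contra hik
  rcases h.disjoint i k hik _ ((E i).getVert_mem_support j) hk with e | e
  · exact h.getVert_ne_start i hj hl.le e
  · exact h.getVert_ne_end i hl e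

theorem IsMelon.adj_getVert_iff (h : IsMelon G E) (i : Fin m) {j : ℕ} (hj : 1 ≤ j)
    (hl : j < (E i).length) (z : V) :
    G.Adj ((E i).getVert j) z ↔ z = (E i).getVert (j - 1) ∨ z = (E i).getVert (j + 1) := by
  constructor
  · intro ha
    obtain ⟨k, hk⟩ := h.edges s((E i).getVert j, z) ha
    obtain rfl := h.eq_of_mem_support hj hl ((E k).fst_mem_support_of_mem_edges hk)
    obtain ⟨l, hl', e⟩ := (E i).mk_mem_edges_iff_exists.1 hk
    rcases Sym2.eq_iff.1 e with ⟨e1, e2⟩ | ⟨e1, e2⟩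
    · obtain rfl := h.getVert_inj i (by omega) (by omega) e1
      exact Or.inr e2.symm
    · obtain rfl := h.getVert_inj i (by omega) (by omega) e2
      exact Or.inl e1.symm
  · rintro (rfl | rfl)
    · have := (E i).adj_getVert_succ (i := j - 1) (by omega)
      rw [Nat.sub_add_cancel hj] at this
      exact this.symm
    · exact (E i).adj_getVert_succ hl

theorem IsMelon.exists_length_one_of_adj (h : IsMelon G E) {a b : V} (ha : a = s ∨ a = t)
    (hb : b = s ∨ b = t) (hab : G.Adj a b) : ∃ i, (E i).length = 1 ∧ s(a, b) ∈ (E i).edges := by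
  obtain ⟨i, hi⟩ := h.edges s(a, b) hab
  refine ⟨i, ?_, hi⟩
  rcases ha with rfl | rfl <;> rcases hb with rfl | rfl
  · exact (hab.ne rfl).elim
  · exact (h.isPath i).length_eq_one_of_mem_edges hi
  · exact (h.isPath i).length_eq_one_of_mem_edges (Sym2.eq_swap ▸ hi)
  · exact (hab.ne rfl).elim

/-- The two endpoints together with the vertices of the constituent paths with index in `T`. -/
def pathVerts (E : Fin m → G.Walk s t) (T : Finset (Fin m)) : Set V :=
  {s, t} ∪ {v | ∃ i ∈ T, v ∈ (E i).support}

theorem pathVerts_empty : pathVerts E ∅ = {s, t} := by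
  ext v; simp [pathVerts]

theorem IsMelon.pathVerts_univ (h : IsMelon G E) : pathVerts E Finset.univ = Set.univ := by
  refine Set.eq_univ_of_forall fun v => Or.inr ?_
  obtain ⟨i, hi⟩ := h.vertices v
  exact ⟨i, Finset.mem_univ i, hi⟩

theorem pathVerts_insert (T : Finset (Fin m)) (i : Fin m) :
    pathVerts E (insert i T) =
      addVerts (pathVerts E T) (E i).getVert ((E i).length - 1) := by
  ext v
  simp only [pathVerts, addVerts, Set.mem_union, Set.mem_ofPred_eq, Finset.mem_insert,
    Set.mem_insert_iff, Set.mem_singleton_iff]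
  constructor
  · rintro (h | ⟨j, rfl | hj, hv⟩)
    · exact Or.inl (Or.inl h)
    · obtain ⟨l, rfl, hl⟩ := SimpleGraph.Walk.mem_support_iff_exists_getVert.1 hv
      rcases Nat.eq_zero_or_pos l with rfl | h0
      · simp
      · rcases Nat.lt_or_ge l (E j).length with h1 | h1
        · exact Or.inr ⟨l, h0, by omega, rfl⟩
        · obtain rfl : l = (E j).length := by omega
          simp
    · exact Or.inl (Or.inr ⟨j, hj, hv⟩)
  · rintro ((h | ⟨j, hj, hv⟩) | ⟨l, -, -, rfl⟩)
    · exact Or.inl h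
    · exact Or.inr ⟨j, Or.inr hj, hv⟩
    · exact Or.inr ⟨i, Or.inl rfl, (E i).getVert_mem_support l⟩

theorem IsMelon.isEar (h : IsMelon G E) {T : Finset (Fin m)} {i : Fin m} (hi : i ∉ T) :
    IsEar G (pathVerts E T) (E i).getVert (E i).length where
  inj _ hj _ hk e := h.getVert_inj i hj hk e
  start_mem := by simp [pathVerts]
  end_mem := by simp [pathVerts]
  notMem j h1 h2 := by
    rintro ((e | e) | ⟨k, hk, hv⟩)
    · exact h.getVert_ne_start i h1 h2.le e
    · exact h.getVert_ne_end i h2 e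
    · exact hi (h.eq_of_mem_support h1 h2 hv ▸ hk)
  adj_iff j h1 h2 z := h.adj_getVert_iff i h1 h2 z

theorem IsMelon.length_pos (h : IsMelon G E) (i : Fin m) : 1 ≤ (E i).length := by
  rw [Nat.one_le_iff_ne_zero]
  exact fun e => h.endpoints_ne (SimpleGraph.Walk.eq_of_length_eq_zero e)

theorem pathVerts_insert_of_length_two {T : Finset (Fin m)} {i : Fin m}
    (hi : (E i).length = 2) :
    pathVerts E (insert i T) = insert ((E i).getVert 1) (pathVerts E T) := by
  rw [pathVerts_insert, hi, addVerts_succ, addVerts_zero]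

theorem pathVerts_insert_of_length_one {T : Finset (Fin m)} {i : Fin m} (hi : (E i).length = 1) :
    pathVerts E (insert i T) = pathVerts E T := by
  rw [pathVerts_insert, hi, addVerts_zero]

theorem IsMelon.adj_middle_iff (h : IsMelon G E) {i : Fin m} (hi : (E i).length = 2) (z : V) :
    G.Adj ((E i).getVert 1) z ↔ z = s ∨ z = t := by
  rw [h.adj_getVert_iff i le_rfl (by omega)]
  have := (E i).getVert_length
  rw [hi] at this
  simp [this]

end Melon

/-! ### Words for the two endpoints and for common neighbours -/

section Constructions

variable {V : Type*} [DecidableEq V] {G : SimpleGraph V} {S : Set V}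

theorem representsOn_pair_two {s t : V} [Decidable (G.Adj s t)] (hst : s ≠ t) :
    RepresentsOn G 2 ([s, t] ++ if G.Adj s t then [s, t] else [t, s]) {s, t} where
  count_eq v hv := by
    rcases hv with rfl | rfl <;> split_ifs <;> simp [hst, hst.symm]
  notMem v hv := by
    simp only [Set.mem_insert_iff, Set.mem_singleton_iff, not_or] at hv
    split_ifs <;> simp [hv.1, hv.2]
  adj_iff a ha b hb hab := by
    rcases ha with rfl | rfl <;> rcases hb with rfl | rfl
    · exact (hab rfl).elim
    · split_ifs with h <;> simp [Alternate, h, hst, hst.symm]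
    · rw [G.adj_comm]
      split_ifs with h <;> simp [Alternate, h, hst, hst.symm]
    · exact (hab rfl).elim

theorem representsOn_pair_three {s t : V} [Decidable (G.Adj s t)] (hst : s ≠ t) :
    RepresentsOn G 3 ([s, t] ++ (if G.Adj s t then [s, t] else [t, s]) ++ [s, t]) {s, t} where
  count_eq v hv := by
    rcases hv with rfl | rfl <;> split_ifs <;> simp [hst, hst.symm]
  notMem v hv := by
    simp only [Set.mem_insert_iff, Set.mem_singleton_iff, not_or] at hv
    split_ifs <;> simp [hv.1, hv.2]
  adj_iff a ha b hb hab := by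
    rcases ha with rfl | rfl <;> rcases hb with rfl | rfl
    · exact (hab rfl).elim
    · split_ifs with h <;> simp [Alternate, h, hst, hst.symm]
    · rw [G.adj_comm]
      split_ifs with h <;> simp [Alternate, h, hst, hst.symm]
    · exact (hab rfl).elim

theorem RepresentsOn.common_neighbor_three {A B : List V} {s t c : V} (hst : s ≠ t)
    (h : RepresentsOn G 3 (A ++ [s, t] ++ B ++ [s, t]) S) (hs : s ∈ S) (ht : t ∈ S)
    (hBs : B.count s = 1) (hBt : B.count t = 1) (hc : c ∉ S)
    (hadj : ∀ z ∈ S, G.Adj c z ↔ z = s ∨ z = t) :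
    -- By uniformity `A` contains neither `s` nor `t`, so `c` alternates with both; the factor `c s
    -- t c` excludes every other letter.
    RepresentsOn G 3 ((A ++ [c]) ++ [s, t] ++ (c :: B ++ [c]) ++ [s, t]) (Insert.insert c S) := by
  have hm := h.notMem c hc
  simp only [List.mem_append, List.mem_cons, not_or] at hm
  obtain ⟨⟨⟨cA, cs, ct, -⟩, cB⟩, -⟩ := hm
  have hs0 : A.count s = 0 := by
    have := h.count_eq s hs
    simp [List.count_append, hst.symm] at this
    omega
  have ht0 : A.count t = 0 := by
    have := h.count_eq t ht
    simp [List.count_append, hst] at this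
    omega
  refine h.insert ?_ ?_ ?_
  · simp only [List.filter_append, List.filter_cons, filter_ne_of_notMem, cA, cB,
      not_false_eq_true]
    simp [Ne.symm cs, Ne.symm ct]
  · simp [List.count_append, List.count_eq_zero_of_not_mem, cA, cB, Ne.symm cs, Ne.symm ct]
  · intro z hz hzc
    rw [hadj z hz]
    constructor
    · rintro (rfl | rfl)
      · unfold Alternate
        simp only [List.filter_append, List.filter_cons, filter_pair_of_notMem_left cA,
          filter_pair_of_notMem_left cB, hBs, hs0]
        simp [cs, Ne.symm cs, hst.symm, Ne.symm ct]
      · unfold Alternate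
        simp only [List.filter_append, List.filter_cons, filter_pair_of_notMem_left cA,
          filter_pair_of_notMem_left cB, hBt, ht0]
        simp [ct, Ne.symm ct, hst, Ne.symm cs]
    · intro ha
      by_contra hz'
      rw [not_or] at hz'
      refine not_alternate_of_gap (P := A) (M := [s, t]) (Q := B ++ [c, s, t]) (u := c) (z := z)
        (by simp [hz'.1, hz'.2]) ?_
      simpa using ha

end Constructions

/-! ### Words representing melon graphs -/

section MelonWords

variable {V : Type*} [DecidableEq V] {G : SimpleGraph V} {s t : V} {m : ℕ}
  {E : Fin m → G.Walk s t}

/-- The middle vertices of paths of length two are wrapped around the first factor `s t`, which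
therefore survives. The last factor also survives, and its order encodes whether `s` and `t` are
adjacent; a path of length one adds no vertex. -/
theorem IsMelon.representsOn_two_of_length_le [Decidable (G.Adj s t)] (h : IsMelon G E) (T : Finset (Fin m))
    (hT : ∀ i ∈ T, (E i).length ≤ 2) :
    ∃ A B, RepresentsOn G 2
      (A ++ [s, t] ++ B ++ (if G.Adj s t then [s, t] else [t, s])) (pathVerts E T) := by
  have hst := h.endpoints_ne
  induction T using Finset.induction_on with
  | empty => exact ⟨[], [], by simpa [pathVerts_empty] using representsOn_pair_two (G := G) hst⟩
  | insert i T hi ih =>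
    obtain ⟨A, B, hw⟩ := ih fun j hj => hT j (Finset.mem_insert_of_mem hj)
    have h1 := h.length_pos i
    have h2 := hT i (Finset.mem_insert_self i T)
    rcases Nat.lt_or_ge (E i).length 2 with h3 | h3
    · exact ⟨A, B, by rwa [pathVerts_insert_of_length_one (by omega)]⟩
    · have hi2 : (E i).length = 2 := by omega
      rw [pathVerts_insert_of_length_two hi2]
      have := RepresentsOn.window (L := [s, t]) (by simpa only [List.append_assoc] using hw)
        ((h.isEar hi).notMem 1 le_rfl (by omega))
        (fun z hz => by
          rw [h.adj_middle_iff hi2]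
          by_cases e : z = s
          · simp [e, hst.symm]
          · by_cases e' : z = t
            · simp [e', hst]
            · simp [e, e', Ne.symm e, Ne.symm e'])
      exact ⟨A ++ [(E i).getVert 1], (E i).getVert 1 :: B, by simpa using this⟩

theorem IsMelon.representsOn_three_of_length_le (h : IsMelon G E) (T : Finset (Fin m))
    (hT : ∀ i ∈ T, (E i).length ≤ 2) :
    ∃ A B, RepresentsOn G 3 (A ++ [s, t] ++ B ++ [s, t]) (pathVerts E T) ∧
      B.count s = 1 ∧ B.count t = 1 := by
  classical
  have hst := h.endpoints_ne
  induction T using Finset.induction_on with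
  | empty =>
    refine ⟨[], if G.Adj s t then [s, t] else [t, s], ?_, ?_⟩
    · simpa [pathVerts_empty] using representsOn_pair_three (G := G) hst
    · split_ifs <;> simp [hst, hst.symm]
  | insert i T hi ih =>
    obtain ⟨A, B, hw, hBs, hBt⟩ := ih fun j hj => hT j (Finset.mem_insert_of_mem hj)
    have h1 := h.length_pos i
    have h2 := hT i (Finset.mem_insert_self i T)
    rcases Nat.lt_or_ge (E i).length 2 with h3 | h3
    · exact ⟨A, B, by rwa [pathVerts_insert_of_length_one (by omega)], hBs, hBt⟩
    · have hi2 : (E i).length = 2 := by omega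
      rw [pathVerts_insert_of_length_two hi2]
      refine ⟨_, _, hw.common_neighbor_three hst (by simp [pathVerts]) (by simp [pathVerts])
        hBs hBt ((h.isEar hi).notMem 1 le_rfl (by omega)) (fun z _ => h.adj_middle_iff hi2 z), ?_⟩
      have hs := h.getVert_ne_start i (j := 1) le_rfl (by omega)
      have ht := h.getVert_ne_end i (j := 1) (by omega)
      simp [List.count_append, hBs, hBt, hs, ht]

theorem IsMelon.kWordRepresentable_three (h : IsMelon G E) : KWordRepresentable 3 G := by
  have key : ∀ T : Finset (Fin m), ∃ w, RepresentsOn G 3 w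
      (pathVerts E (T ∪ Finset.univ.filter fun i => (E i).length ≤ 2)) := by
    intro T
    induction T using Finset.induction_on with
    | empty =>
      obtain ⟨A, B, hw, -⟩ := h.representsOn_three_of_length_le
        (Finset.univ.filter fun i => (E i).length ≤ 2) (fun i hi => by simpa using hi)
      exact ⟨_, by simpa using hw⟩
    | insert i T hi ih =>
      obtain ⟨w, hw⟩ := ih
      rw [Finset.insert_union]
      by_cases hm : i ∈ T ∪ Finset.univ.filter fun i => (E i).length ≤ 2
      · rw [Finset.insert_eq_of_mem hm]
        exact ⟨w, hw⟩
      · rw [pathVerts_insert]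
        refine hw.add_ear_three (h.isEar hm) ?_
        simp at hm
        omega
  obtain ⟨w, hw⟩ := key Finset.univ
  rw [Finset.union_eq_left.2 (Finset.subset_univ _), h.pathVerts_univ] at hw
  exact hw.kWordRepresentable (by norm_num)

theorem IsMelon.kWordRepresentable_two (h : IsMelon G E)
    (hcard : (Finset.univ.filter fun i => 3 ≤ (E i).length).card ≤ 2) :
    KWordRepresentable 2 G := by
  classical
  set T := Finset.univ.filter fun i => (E i).length ≤ 2 with hT
  set U := Finset.univ.filter fun i => 3 ≤ (E i).length with hU
  have hTU : U ∪ T = Finset.univ := by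
    ext i
    simp only [hT, hU, Finset.mem_union, Finset.mem_filter, Finset.mem_univ, true_and, iff_true]
    omega
  have hUT : ∀ i ∈ U, i ∉ T := by
    intro i h1 h2
    simp only [hT, hU, Finset.mem_filter, Finset.mem_univ, true_and] at h1 h2
    omega
  have hlong : ∀ i ∈ U, 2 ≤ (E i).length := by
    intro i hi
    simp only [hU, Finset.mem_filter, Finset.mem_univ, true_and] at hi
    omega
  obtain ⟨A, B, hw⟩ := h.representsOn_two_of_length_le T (fun i hi => by simpa [hT] using hi)
  suffices ∃ w, RepresentsOn G 2 w (pathVerts E (U ∪ T)) by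
    obtain ⟨w, hw⟩ := this
    rw [hTU, h.pathVerts_univ] at hw
    exact hw.kWordRepresentable (by norm_num)
  -- The first long path consumes the inner factor `s t` and keeps the final one for a second long
  -- path.
  have add_one : ∀ i ∈ U, ∃ C, RepresentsOn G 2
      (C ++ (if G.Adj s t then [s, t] else [t, s])) (pathVerts E (insert i T)) := by
    intro i hi
    rw [pathVerts_insert]
    obtain ⟨L, hL⟩ := RepresentsOn.add_ear_two (A := A)
      (by simpa only [List.append_assoc, SimpleGraph.Walk.getVert_zero,
        SimpleGraph.Walk.getVert_length] using hw) (h.isEar (hUT i hi)) (hlong i hi)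
    exact ⟨A ++ L ++ B, by simpa only [List.append_assoc] using hL⟩
  have hcases : U.card = 0 ∨ U.card = 1 ∨ U.card = 2 := by omega
  rcases hcases with h0 | h1 | h2
  · rw [Finset.card_eq_zero.1 h0, Finset.empty_union]
    exact ⟨_, hw⟩
  · obtain ⟨i, hi⟩ := Finset.card_eq_one.1 h1
    obtain ⟨C, hC⟩ := add_one i (by simp [hi])
    rw [hi]
    exact ⟨_, hC⟩
  · obtain ⟨i, j, hij, hU'⟩ := Finset.card_eq_two.1 h2
    obtain ⟨C, hC⟩ := add_one i (by simp [hU'])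
    have hjU : j ∈ U := by simp [hU']
    have hj : j ∉ insert i T := by
      rw [Finset.mem_insert, not_or]
      exact ⟨hij.symm, hUT j hjU⟩
    have e : U ∪ T = insert j (insert i T) := by
      rw [hU']
      ext x
      simp only [Finset.mem_union, Finset.mem_insert, Finset.mem_singleton]
      tauto
    rw [e, pathVerts_insert]
    have hear := h.isEar hj
    by_cases hst : G.Adj s t
    · rw [if_pos hst] at hC
      obtain ⟨L, hL⟩ := RepresentsOn.add_ear_two (A := C) (B := []) (by simpa using hC)
        hear (hlong j hjU)
      exact ⟨_, hL⟩
    · rw [if_neg hst] at hC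
      -- The remaining factor reads `t s`, so the second path is traversed from `t` to `s`.
      rw [← addVerts_reverse]
      obtain ⟨L, hL⟩ := RepresentsOn.add_ear_two (A := C) (B := []) (by simpa using hC)
        hear.reverse (hlong j hjU)
      exact ⟨_, hL⟩

end MelonWords

/-! ### Chord diagrams of 2-uniform words -/

section Chords

variable {V : Type*}

/-- `f v < g v` are the endpoints of a chord for every vertex `v`; no two chords have a common
endpoint, and vertices are adjacent in `G` if and only if their chords cross. -/
structure IsChordModel (G : SimpleGraph V) (f g : V → ℕ) : Prop where
  lt : ∀ v, f v < g v
  ff : ∀ a b, a ≠ b → f a ≠ f b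
  fg : ∀ a b, a ≠ b → f a ≠ g b
  gg : ∀ a b, a ≠ b → g a ≠ g b
  adj_iff : ∀ a b, a ≠ b →
    (G.Adj a b ↔ (f a < f b ∧ f b < g a ∧ g a < g b) ∨ (f b < f a ∧ f a < g b ∧ g b < g a))

theorem exists_positions_of_count_eq_two [DecidableEq V] {w : List V} {v : V}
    (h : w.count v = 2) : ∃ i j : ℕ, i < j ∧ ∀ k, w[k]? = some v ↔ k = i ∨ k = j := by
  have h1 : w.filter (· = v) = [v, v] := by rw [List.filter_eq, h]; rfl
  obtain ⟨P, w1, rfl, hP, -, h1⟩ := List.filter_eq_cons_iff.1 h1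
  obtain ⟨A, B, rfl, hA, -, h1⟩ := List.filter_eq_cons_iff.1 h1
  rw [List.filter_eq_nil_iff] at h1
  have hP' : v ∉ P := fun h => hP _ h (by simp)
  have hA' : v ∉ A := fun h => hA _ h (by simp)
  have hB' : v ∉ B := fun h => h1 _ h (by simp)
  refine ⟨P.length, P.length + 1 + A.length, by omega, fun k => ⟨fun hk => ?_, ?_⟩⟩
  · by_contra hne
    rw [List.getElem?_append] at hk
    split_ifs at hk with h2
    · exact hP' (List.mem_of_getElem? hk)
    obtain ⟨l, hl⟩ : ∃ l, k - P.length = l + 1 := ⟨k - P.length - 1, by omega⟩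
    rw [hl, List.getElem?_cons_succ, List.getElem?_append] at hk
    split_ifs at hk with h3
    · exact hA' (List.mem_of_getElem? hk)
    obtain ⟨l', hl'⟩ : ∃ l', l - A.length = l' + 1 := ⟨l - A.length - 1, by omega⟩
    rw [hl', List.getElem?_cons_succ] at hk
    exact hB' (List.mem_of_getElem? hk)
  · rintro (rfl | rfl)
    · simp
    · rw [List.getElem?_append_right (by omega),
        show P.length + 1 + A.length - P.length = A.length + 1 by omega]
      simp

theorem exists_four_positions {w : List V} {q : V → Bool} {a b c d : V}
    (h : w.filter q = [a, b, c, d]) :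
    ∃ i j k l : ℕ, i < j ∧ j < k ∧ k < l ∧ w[i]? = some a ∧ w[j]? = some b ∧ w[k]? = some c ∧
      w[l]? = some d := by
  obtain ⟨P, w1, rfl, -, -, h⟩ := List.filter_eq_cons_iff.1 h
  obtain ⟨Q, w2, rfl, -, -, h⟩ := List.filter_eq_cons_iff.1 h
  obtain ⟨R, w3, rfl, -, -, h⟩ := List.filter_eq_cons_iff.1 h
  obtain ⟨T, w4, rfl, -, -, h⟩ := List.filter_eq_cons_iff.1 h
  have app : ∀ (A B : List V) (n : ℕ), (A ++ B)[A.length + n]? = B[n]? := fun A B n => by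
    rw [List.getElem?_append_right (Nat.le_add_right _ _), Nat.add_sub_cancel_left]
  have app0 : ∀ A B : List V, (A ++ B)[A.length]? = B[0]? := fun A B => app A B 0
  refine ⟨P.length, P.length + (Q.length + 1), P.length + ((Q.length + (R.length + 1)) + 1),
    P.length + ((Q.length + ((R.length + (T.length + 1)) + 1)) + 1), by omega, by omega, by omega,
    ?_, ?_, ?_, ?_⟩ <;>
  simp only [app, app0, List.getElem?_cons_succ, List.getElem?_cons_zero]

theorem exists_isChordModel [DecidableEq V] {G : SimpleGraph V} (h : KWordRepresentable 2 G) :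
    ∃ f g, IsChordModel G f g := by
  obtain ⟨-, w, hu, hr⟩ := h
  choose f g hlt hpos using fun v => exists_positions_of_count_eq_two (hu v)
  have hdisj : ∀ (a b : V) (k : ℕ), a ≠ b → w[k]? = some a → w[k]? ≠ some b := by
    intro a b k hab h1 h2
    rw [h1] at h2
    exact hab (Option.some.inj h2)
  have hf : ∀ v, w[f v]? = some v := fun v => (hpos v _).2 (Or.inl rfl)
  have hg : ∀ v, w[g v]? = some v := fun v => (hpos v _).2 (Or.inr rfl)
  refine ⟨f, g, hlt, ?_, ?_, ?_, ?_⟩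
  · exact fun a b hab e => hdisj a b _ hab (hf a) (e ▸ hf b)
  · exact fun a b hab e => hdisj a b _ hab (hf a) (e ▸ hg b)
  · exact fun a b hab e => hdisj a b _ hab (hg a) (e ▸ hg b)
  · intro a b hab
    rw [hr a b hab]
    unfold Alternate
    have hla := hlt a
    have hlb := hlt b
    have hca : (w.filter fun x => x = a ∨ x = b).count a = 2 := by
      rw [List.count_filter (by simp), hu a]
    have hcb : (w.filter fun x => x = a ∨ x = b).count b = 2 := by
      rw [List.count_filter (by simp), hu b]
    have hmem : ∀ x ∈ w.filter fun x => x = a ∨ x = b, x = a ∨ x = b :=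
      fun x hx => by simpa using (List.mem_filter.1 hx).2
    have hlen : (w.filter fun x => x = a ∨ x = b).length = 4 := by
      rw [length_eq_count_add_count hab hmem, hca, hcb]
    generalize hl : w.filter (fun x => x = a ∨ x = b) = l at *
    match l, hlen with
    | [c₁, c₂, c₃, c₄], _ =>
      obtain ⟨i₁, i₂, i₃, i₄, h12, h23, h34, e1, e2, e3, e4⟩ := exists_four_positions hl
      have m1 := hmem c₁ (by simp)
      have m2 := hmem c₂ (by simp)
      have m3 := hmem c₃ (by simp)
      have m4 := hmem c₄ (by simp)
      clear hmem hl
      rcases m1 with m1 | m1 <;> rcases m2 with m2 | m2 <;> rcases m3 with m3 | m3 <;>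
        rcases m4 with m4 | m4 <;>
        simp [m1, m2, m3, m4, hab, hab.symm] at hca hcb ⊢ <;>
        simp only [m1, m2, m3, m4, hpos] at e1 e2 e3 e4 <;> omega

/-- The chord of `z` lies between the two endpoints of the chord of `a`. -/
def Inside (f g : V → ℕ) (a z : V) : Prop := f a < f z ∧ f z < g a

/-- Two crossing chords that both avoid the chord of `a` cannot lie on different sides of it. -/
theorem IsChordModel.inside_iff {G : SimpleGraph V} {f g : V → ℕ} (h : IsChordModel G f g)
    {a z z' : V} (hz : a ≠ z) (hz' : a ≠ z') (haz : ¬ G.Adj a z) (haz' : ¬ G.Adj a z')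
    (hadj : G.Adj z z') : Inside f g a z ↔ Inside f g a z' := by
  have hne := hadj.ne
  rw [h.adj_iff _ _ hz] at haz
  rw [h.adj_iff _ _ hz'] at haz'
  rw [h.adj_iff _ _ hne] at hadj
  have := h.lt a
  have := h.lt z
  have := h.lt z'
  have := h.ff _ _ hz
  have := h.ff _ _ hz'
  have := h.fg _ _ hz
  have := h.fg _ _ hz'
  have := h.fg _ _ hz.symm
  have := h.fg _ _ hz'.symm
  have := h.gg _ _ hz
  have := h.gg _ _ hz'
  unfold Inside
  omega

/-- Disjoint chords crossing a common chord are ordered along it, and the middle one has the other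
two on different sides. The last three hypotheses deny this for each candidate. -/
theorem IsChordModel.inside_trichotomy {G : SimpleGraph V} {f g : V → ℕ}
    (h : IsChordModel G f g) {s a b c : V} (hsa : G.Adj s a) (hsb : G.Adj s b) (hsc : G.Adj s c)
    (hab : a ≠ b) (hac : a ≠ c) (hbc : b ≠ c) (nab : ¬ G.Adj a b) (nac : ¬ G.Adj a c)
    (nbc : ¬ G.Adj b c) (ha : Inside f g a b ↔ Inside f g a c)
    (hb : Inside f g b a ↔ Inside f g b c) (hc : Inside f g c a ↔ Inside f g c b) : False := by
  have nsa := hsa.ne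
  have nsb := hsb.ne
  have nsc := hsc.ne
  rw [h.adj_iff _ _ nsa] at hsa
  rw [h.adj_iff _ _ nsb] at hsb
  rw [h.adj_iff _ _ nsc] at hsc
  rw [h.adj_iff _ _ hab] at nab
  rw [h.adj_iff _ _ hac] at nac
  rw [h.adj_iff _ _ hbc] at nbc
  have := h.lt s
  have := h.lt a
  have := h.lt b
  have := h.lt c
  have := h.ff _ _ hab
  have := h.ff _ _ hac
  have := h.ff _ _ hbc
  have := h.fg _ _ hab
  have := h.fg _ _ hac
  have := h.fg _ _ hbc
  have := h.fg _ _ hab.symm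
  have := h.fg _ _ hac.symm
  have := h.fg _ _ hbc.symm
  have := h.gg _ _ hab
  have := h.gg _ _ hac
  have := h.gg _ _ hbc
  unfold Inside at ha hb hc
  rcases hsa with hsa | hsa <;> rcases hsb with hsb | hsb <;> rcases hsc with hsc | hsc <;> omega

end Chords

/-! ### Three long paths exclude 2-uniform words -/

section NotRepresentable

variable {V : Type*} {G : SimpleGraph V} {s t : V} {m : ℕ} {E : Fin m → G.Walk s t}

/-- The neighbours of the first vertex of a long path are `s` and an interior vertex of the same
path; length at least three ensures that the latter is not `t`. -/
theorem IsMelon.not_adj_getVert_one (h : IsMelon G E) {i j : Fin m} (hij : i ≠ j)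
    (hi : 3 ≤ (E i).length) {k : ℕ} (hk : 1 ≤ k) (hkj : k ≤ (E j).length) :
    (E i).getVert 1 ≠ (E j).getVert k ∧ ¬ G.Adj ((E i).getVert 1) ((E j).getVert k) := by
  have key : ∀ l, 1 ≤ l → l < (E i).length → (E i).getVert l ≠ (E j).getVert k :=
    fun l h1 h2 e => hij (h.eq_of_mem_support h1 h2 (e ▸ (E j).getVert_mem_support k))
  refine ⟨key 1 le_rfl (by omega), ?_⟩
  rw [h.adj_getVert_iff i le_rfl (by omega)]
  rintro (e | e)
  · exact h.getVert_ne_start j hk hkj (by simpa using e)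
  · exact key 2 (by omega) (by omega) e.symm

/-- Going along `E j` from its first vertex to `t`, one never meets the first vertex of `E i` or its
neighbours, so the side of its chord never changes. -/
theorem IsMelon.inside_end_iff (h : IsMelon G E) {f g : V → ℕ} (hfg : IsChordModel G f g)
    {i j : Fin m} (hij : i ≠ j) (hi : 3 ≤ (E i).length) :
    Inside f g ((E i).getVert 1) ((E j).getVert 1) ↔ Inside f g ((E i).getVert 1) t := by
  have key : ∀ k, k + 1 ≤ (E j).length → (Inside f g ((E i).getVert 1) ((E j).getVert 1) ↔
      Inside f g ((E i).getVert 1) ((E j).getVert (k + 1))) := by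
    intro k
    induction k with
    | zero => exact fun _ => Iff.rfl
    | succ k ih =>
      intro hk
      have h1 := h.not_adj_getVert_one hij hi (k := k + 1) (by omega) (by omega)
      have h2 := h.not_adj_getVert_one hij hi (k := k + 1 + 1) (by omega) (by omega)
      rw [ih (by omega), hfg.inside_iff h1.1 h2.1 h1.2 h2.2 ((E j).adj_getVert_succ (by omega))]
  have hl := h.length_pos j
  have := key ((E j).length - 1) (by omega)
  rwa [Nat.sub_add_cancel hl, SimpleGraph.Walk.getVert_length] at this

theorem IsMelon.not_isChordModel (h : IsMelon G E) {f g : V → ℕ} (hfg : IsChordModel G f g)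
    {i j k : Fin m} (hij : i ≠ j) (hik : i ≠ k) (hjk : j ≠ k) (hi : 3 ≤ (E i).length)
    (hj : 3 ≤ (E j).length) (hk : 3 ≤ (E k).length) : False := by
  have hs : ∀ l : Fin m, G.Adj s ((E l).getVert 1) := fun l => by
    simpa using (E l).adj_getVert_succ (i := 0) (h.length_pos l)
  have hn : ∀ l l' : Fin m, l ≠ l' → 3 ≤ (E l).length →
      (E l).getVert 1 ≠ (E l').getVert 1 ∧ ¬ G.Adj ((E l).getVert 1) ((E l').getVert 1) :=
    fun l l' hll hl => h.not_adj_getVert_one hll hl le_rfl (h.length_pos l')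
  refine hfg.inside_trichotomy (hs i) (hs j) (hs k) (hn i j hij hi).1 (hn i k hik hi).1
    (hn j k hjk hj).1 (hn i j hij hi).2 (hn i k hik hi).2 (hn j k hjk hj).2 ?_ ?_ ?_
  · rw [h.inside_end_iff hfg hij hi, h.inside_end_iff hfg hik hi]
  · rw [h.inside_end_iff hfg hij.symm hj, h.inside_end_iff hfg hjk hj]
  · rw [h.inside_end_iff hfg hik.symm hk, h.inside_end_iff hfg hjk.symm hk]

theorem adj_of_kWordRepresentable_one [DecidableEq V] (h : KWordRepresentable 1 G) {a b : V}
    (hab : a ≠ b) : G.Adj a b := by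
  obtain ⟨-, w, hu, hr⟩ := h
  rw [hr a b hab]
  have : w.Nodup := List.nodup_iff_count_le_one.2 fun v => (hu v).le
  exact (this.filter _).isChain

theorem IsChordModel.induce {f g : V → ℕ} (h : IsChordModel G f g) (S : Set V) :
    IsChordModel (G.induce S) (fun v => f v) (fun v => g v) where
  lt v := h.lt v
  ff a b hab := h.ff a b (Subtype.coe_injective.ne hab)
  fg a b hab := h.fg a b (Subtype.coe_injective.ne hab)
  gg a b hab := h.gg a b (Subtype.coe_injective.ne hab)
  adj_iff a b hab := h.adj_iff a b (Subtype.coe_injective.ne hab)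

theorem HasInducedM3OrM4.exists_three_long (h : HasInducedM3OrM4 G) :
    ∃ (S : Set V) (s t : S) (m : ℕ) (E : Fin m → (G.induce S).Walk s t), IsMelon _ E ∧
      ∃ i j k, i ≠ j ∧ i ≠ k ∧ j ≠ k ∧ 3 ≤ (E i).length ∧ 3 ≤ (E j).length ∧
        3 ≤ (E k).length := by
  obtain ⟨S, ⟨s, t, E, hE, hl⟩ | ⟨s, t, E, hE, i, -, hl⟩⟩ := h
  · exact ⟨S, s, t, 3, E, hE, 0, 1, 2, by decide, by decide, by decide, hl 0, hl 1, hl 2⟩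
  -- Addition in `Fin 4` is modulo four, so these are the three indices other than `i`.
  · refine ⟨S, s, t, 4, E, hE, i + 1, i + 2, i + 3, ?_, ?_, ?_, hl _ ?_, hl _ ?_, hl _ ?_⟩ <;>
      (clear hl; revert i; decide)

theorem HasInducedM3OrM4.not_kWordRepresentable_two [DecidableEq V] (h : HasInducedM3OrM4 G) :
    ¬ KWordRepresentable 2 G := by
  intro h2
  obtain ⟨f, g, hfg⟩ := exists_isChordModel h2
  obtain ⟨S, s, t, m, E, hE, i, j, k, hij, hik, hjk, hi, hj, hk⟩ := h.exists_three_long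
  exact hE.not_isChordModel (hfg.induce S) hij hik hjk hi hj hk

theorem HasInducedM3OrM4.not_kWordRepresentable_one [DecidableEq V] (h : HasInducedM3OrM4 G) :
    ¬ KWordRepresentable 1 G := by
  intro h1
  obtain ⟨S, s, t, m, E, hE, i, j, k, hij, hik, hjk, hi, hj, hk⟩ := h.exists_three_long
  have := hE.not_adj_getVert_one hij hi (k := 1) le_rfl (by omega)
  exact this.2 (adj_of_kWordRepresentable_one h1 (Subtype.coe_injective.ne this.1))

end NotRepresentable

/-! ### Subfamilies of paths as induced melon graphs -/

section Induced

variable {V : Type*} {G : SimpleGraph V} {s t : V} {m : ℕ} {E : Fin m → G.Walk s t}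

theorem length_induce {S : Set V} {u v : V} (p : G.Walk u v) (hp : ∀ x ∈ p.support, x ∈ S) :
    (p.induce S hp).length = p.length := by
  have h1 := congrArg List.length (p.support_induce hp)
  rw [List.length_attachWith, SimpleGraph.Walk.length_support,
    SimpleGraph.Walk.length_support] at h1
  exact Nat.succ_injective h1

theorem map_edges_induce {S : Set V} {u v : V} (p : G.Walk u v)
    (hp : ∀ x ∈ p.support, x ∈ S) :
    (p.induce S hp).edges.map (Sym2.map Subtype.val) = p.edges :=
  (SimpleGraph.Walk.edges_map (SimpleGraph.Embedding.induce S).toHom _).symm.trans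
    (congrArg SimpleGraph.Walk.edges (p.map_induce hp))

/-- The hypothesis `hone` is what makes the subgraph induced: an edge of an omitted path with both
ends in `S` must join `s` and `t`, so it forms a path of length one, which is among those kept. -/
theorem IsMelon.induce (h : IsMelon G E) {r : ℕ} (hr : 0 < r) (e : Fin r → Fin m)
    (he : Function.Injective e) (hone : ∀ i, (E i).length = 1 → i ∈ Set.range e) {S : Set V}
    (hS : S = {v | ∃ k, v ∈ (E (e k)).support}) (hsup : ∀ k, ∀ x ∈ (E (e k)).support, x ∈ S)
    (hs : s ∈ S) (ht : t ∈ S) :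
    IsMelon (G.induce S) (s := ⟨s, hs⟩) (t := ⟨t, ht⟩)
      (fun k => (E (e k)).induce S (hsup k)) where
  pos := hr
  endpoints_ne hst := h.endpoints_ne (congrArg Subtype.val hst)
  isPath k := by
    refine SimpleGraph.Walk.IsPath.of_map (f := (SimpleGraph.Embedding.induce S).toHom) ?_
    rw [SimpleGraph.Walk.map_induce]
    exact h.isPath _
  disjoint i j hij v hi hj := by
    rw [SimpleGraph.Walk.support_induce, List.mem_attachWith] at hi hj
    rcases h.disjoint _ _ (he.ne hij) v hi hj with e | e
    · exact Or.inl (Subtype.ext e)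
    · exact Or.inr (Subtype.ext e)
  length_one i j hi hj := by
    rw [length_induce] at hi hj
    exact he (h.length_one _ _ hi hj)
  vertices := by
    rintro ⟨v, hv⟩
    have hv' := hv
    rw [hS] at hv'
    obtain ⟨k, hk⟩ := hv'
    refine ⟨k, ?_⟩
    rw [SimpleGraph.Walk.support_induce, List.mem_attachWith]
    exact hk
  edges := by
    intro a
    induction a using Sym2.ind with
    | _ a b =>
    intro hab
    have hab : G.Adj a b := hab
    have key : ∃ k, s((a : V), (b : V)) ∈ (E (e k)).edges := by
      obtain ⟨i, hi⟩ := h.edges s((a : V), (b : V)) hab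
      by_cases hie : i ∈ Set.range e
      · obtain ⟨k, rfl⟩ := hie
        exact ⟨k, hi⟩
      · have hend : ∀ v : V, v ∈ S → v ∈ (E i).support → v = s ∨ v = t := by
          intro v hv hvi
          rw [hS] at hv
          obtain ⟨k, hk⟩ := hv
          exact h.disjoint i (e k) (fun hh => hie ⟨k, hh.symm⟩) v hvi hk
        obtain ⟨j, hj, hj'⟩ := h.exists_length_one_of_adj
          (hend a a.2 ((E i).fst_mem_support_of_mem_edges hi))
          (hend b b.2 ((E i).snd_mem_support_of_mem_edges hi)) hab
        obtain ⟨k, rfl⟩ := hone j hj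
        exact ⟨k, hj'⟩
    obtain ⟨k, hk⟩ := key
    refine ⟨k, ?_⟩
    rw [← map_edges_induce (E (e k)) (hsup k), List.mem_map] at hk
    obtain ⟨x, hx, hxe⟩ := hk
    have : x = s(a, b) := by
      refine Sym2.map.injective (f := Subtype.val) Subtype.val_injective ?_
      simpa using hxe
    exact this ▸ hx

theorem IsMelon.hasInducedM3OrM4 (h : IsMelon G E)
    (hcard : 2 < (Finset.univ.filter fun i => 3 ≤ (E i).length).card) : HasInducedM3OrM4 G := by
  obtain ⟨i, j, k, hi, hj, hk, hij, hik, hjk⟩ := Finset.two_lt_card_iff.1 hcard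
  simp only [Finset.mem_filter, Finset.mem_univ, true_and] at hi hj hk
  by_cases hone : ∃ l, (E l).length = 1
  · obtain ⟨l, hl⟩ := hone
    have hli : l ≠ i := by rintro rfl; omega
    have hlj : l ≠ j := by rintro rfl; omega
    have hlk : l ≠ k := by rintro rfl; omega
    let e : Fin 4 → Fin m := ![l, i, j, k]
    have he : Function.Injective e := by
      intro a b hab
      fin_cases a <;> fin_cases b <;>
        simp [e, hli, hlj, hlk, hij, hik, hjk, hli.symm, hlj.symm, hlk.symm, hij.symm, hik.symm,
          hjk.symm] at hab ⊢
    refine ⟨{v | ∃ k, v ∈ (E (e k)).support}, Or.inr ⟨⟨s, 0, (E _).start_mem_support⟩,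
      ⟨t, 0, (E _).end_mem_support⟩, _, h.induce (by norm_num) e he
      (fun l' hl' => ⟨0, h.length_one _ _ hl hl'⟩) rfl (fun k x hx => ⟨k, hx⟩) _ _, 0, ?_, ?_⟩⟩
    · rw [length_induce]
      exact hl
    · intro a ha
      rw [length_induce]
      fin_cases a
      · exact (ha rfl).elim
      · exact hi
      · exact hj
      · exact hk
  · let e : Fin 3 → Fin m := ![i, j, k]
    have he : Function.Injective e := by
      intro a b hab
      fin_cases a <;> fin_cases b <;>
        simp [e, hij, hik, hjk, hij.symm, hik.symm, hjk.symm] at hab ⊢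
    refine ⟨{v | ∃ k, v ∈ (E (e k)).support}, Or.inl ⟨⟨s, 0, (E _).start_mem_support⟩,
      ⟨t, 0, (E _).end_mem_support⟩, _, h.induce (by norm_num) e he
      (fun l' hl' => (hone ⟨l', hl'⟩).elim) rfl (fun k x hx => ⟨k, hx⟩) _ _, ?_⟩⟩
    intro a
    rw [length_induce]
    fin_cases a
    · exact hi
    · exact hj
    · exact hk

end Induced

theorem KWordRepresentable.representationNumber_le {V : Type*} [DecidableEq V]
    {G : SimpleGraph V} {k : ℕ} (h : KWordRepresentable k G) : representationNumber G ≤ k :=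
  sInf_le ⟨k, h, rfl⟩

end MelonWord

/-! ### The main theorem -/

theorem theorem2p7 {V : Type*} [DecidableEq V] (M : SimpleGraph V)
    (hM : MelonWord.IsMelonGraph M) :
    (MelonWord.representationNumber M = 3 ↔ MelonWord.HasInducedM3OrM4 M) ∧
    (¬ MelonWord.HasInducedM3OrM4 M →
      MelonWord.representationNumber M ≤ 2 ∧ MelonWord.KWordRepresentable 2 M) := by
  obtain ⟨m, s, t, E, hE⟩ := hM
  have htwo : ¬ MelonWord.HasInducedM3OrM4 M → MelonWord.KWordRepresentable 2 M := fun hn =>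
    hE.kWordRepresentable_two (not_lt.1 fun hc => hn (hE.hasInducedM3OrM4 hc))
  refine ⟨⟨fun h3 => ?_, fun hi => le_antisymm ?_ ?_⟩, fun hn => ⟨?_, htwo hn⟩⟩
  · by_contra hn
    have := (htwo hn).representationNumber_le
    rw [h3] at this
    exact absurd this (by decide)
  · exact hE.kWordRepresentable_three.representationNumber_le
  · refine le_sInf ?_
    rintro _ ⟨k, hk, rfl⟩
    have h0 : 0 < k := hk.1
    have h1 : k ≠ 1 := by rintro rfl; exact hi.not_kWordRepresentable_one hk
    have h2 : k ≠ 2 := by rintro rfl; exact hi.not_kWordRepresentable_two hk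
    exact Nat.cast_le (α := ℕ∞).2 (show 3 ≤ k by omega)
  · exact (htwo hn).representationNumber_le
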